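/- Let $d\ge 1$, and write $\mathbb N=\{1,2,\dots\}$, $\mathbb N_0=\mathbb N\cup\{0\}$. For each $i\in\mathbb N$ let $f_i:\mathbb R^d\to\mathbb R^d$ be a contracting similarity, $|f_i(x)-f_i(y)|=\sigma_i|x-y|$ for all $x,y$, with ratio $\sigma_i\in(0,1)$, and for each $k\in\mathbb N$ let $\mathcal I_k\subset\mathbb N$ be a finite non-empty index set. For $k\in\mathbb N_0$, $n\ge 1$ and $B\subseteq\mathbb R^d$ put $$\mathcal S^k(B)=\bigcup_{i\in\mathcal I_{k+1}}f_i(B),\qquad \mathcal S^{k,k+n}=\mathcal S^k\circ\cdots\circ\mathcal S^{k+n-1},\qquad \mathcal J^{k,k+n}=\mathcal I_{k+1}\times\cdots\times\mathcal I_{k+n},$$ and $\sigma_\alpha=\sigma_{i_1}\cdots\sigma_{i_n}$ for $\alpha=(i_1,\dots,i_n)\in\mathcal J^{k,k+n}$. Suppose that the system satisfies the (generalised) Moran open-set condition: there are a uniformly bounded sequence of non-empty open sets $U^k\subset\mathbb R^d$ $(k\in\mathbb N_0)$ and $\epsilon_0>0$ such that $\mathcal S^k(U^{k+1})\subseteq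 U^k$ for all $k\in\mathbb N_0$; $f_i(U^k)\cap f_j(U^k)=\emptyset$ for all $k\in\mathbb N$ and distinct $i,j\in\mathcal I_k$; and each $U^k$ has Lebesgue measure at least $\epsilon_0$. Let $\{F^k\}_{k\in\mathbb N_0}$ be the pullback attractor of the system: the $F^k$ are compact and uniformly bounded, $F^k=\mathcal S^k(F^{k+1})$ for all $k\in\mathbb N_0$, and for every $k\in\mathbb N_0$ and every bounded $B\subset\mathbb R^d$, $\sup_{x\in\mathcal S^{k,l}(B)}\inf_{y\in F^k}|x-y|\to 0$ as $l\to\infty$. Assume that $\inf\{\sigma_i:i\in\mathbb N\}>0$ and that there are constants $s>0$, $n_0\in\mathbb N$ and $L>0$ such that $$L^{-1}\le\sum_{\alpha\in\mathcal J^{k,k+n}}\sigma_\alpha^s\le L\qquad\text{for all }k\in\mathbb N\text{ and all }n\ge n_0 .$$ Then for every $k\in\mathbb N_0$ the set $F^k$ is equi-homogeneous and its Assouad dimension is $\dim_{\rm A}F^k=s$. Here $B_\delta(x)$ is the closed ball, and $\mathcal N(A,\rho)$ is the least number of closed balls of radius $\rho$ with centres in $A$ whose union contains $A$. A set $F$ is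 equi-homogeneous if for every $\delta_0>0$ there are $M\ge 1$ and $c_1,c_2>0$ such that $\sup_{x\in F}\mathcal N(B_\delta(x)\cap F,\rho)\le M\inf_{x\in F}\mathcal N(B_{c_1\delta}(x)\cap F,c_2\rho)$ whenever $0<\rho<\delta\le\delta_0$. The Assouad dimension $\dim_{\rm A}F$ is the infimum of the $t\ge 0$ such that for every $\delta_0>0$ there is $C>0$ with $\sup_{x\in F}\mathcal N(B_\delta(x)\cap F,\rho)\le C(\delta/\rho)^t$ whenever $0<\rho<\delta\le\delta_0$. -/

import Mathlib

open Set Filter Topology MeasureTheory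
open scoped NNReal ENNReal

noncomputable section

/-- `𝒩(B_δ(x) ∩ F, ρ)`: the least number of closed `ρ`-balls, with centres in `B_δ(x) ∩ F`, whose
union contains `B_δ(x) ∩ F`, where `B_δ(x)` is the closed ball. -/
def localCover {X : Type*} [PseudoMetricSpace X] (F : Set X) (x : X) (δ ρ : ℝ≥0) : ℝ≥0∞ :=
  ((Metric.coveringNumber ρ (Metric.closedBall x (δ : ℝ) ∩ F) : ℕ∞) : ℝ≥0∞)

/-- `s` is an admissible exponent in the definition of the Assouad dimension of `F`. -/
def IsAssouadExponent {X : Type*} [PseudoMetricSpace X] (F : Set X) (s : ℝ≥0) : Prop :=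
  ∀ δ₀ : ℝ≥0, 0 < δ₀ → ∃ C : ℝ≥0, 0 < C ∧ ∀ δ ρ : ℝ≥0, 0 < ρ → ρ < δ → δ ≤ δ₀ →
    (⨆ x ∈ F, localCover F x δ ρ) ≤ ((C * (δ / ρ) ^ (s : ℝ) : ℝ≥0) : ℝ≥0∞)

/-- The Assouad dimension: the infimum of the admissible exponents (`∞` if there are none). -/
def assouadDim {X : Type*} [PseudoMetricSpace X] (F : Set X) : ℝ≥0∞ :=
  ⨅ (s : ℝ≥0) (_ : IsAssouadExponent F s), (s : ℝ≥0∞)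

/-- Equi-homogeneous subsets of a metric space. -/
def IsEquiHomogeneous {X : Type*} [PseudoMetricSpace X] (F : Set X) : Prop :=
  ∀ δ₀ : ℝ≥0, 0 < δ₀ → ∃ M c₁ c₂ : ℝ≥0, 1 ≤ M ∧ 0 < c₁ ∧ 0 < c₂ ∧
    ∀ δ ρ : ℝ≥0, 0 < ρ → ρ < δ → δ ≤ δ₀ →
      (⨆ x ∈ F, localCover F x δ ρ) ≤ (M : ℝ≥0∞) * ⨅ x ∈ F, localCover F x (c₁ * δ) (c₂ * ρ)

/-- The Hausdorff semi-distance `sup_{x ∈ A} inf_{y ∈ B} |x - y|`. -/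
def hausdorffSemiDist {X : Type*} [PseudoMetricSpace X] (A B : Set X) : ℝ≥0∞ :=
  ⨆ x ∈ A, Metric.infEDist x B

/-- A non-autonomous iterated function system on `ℝᵈ`: contractions `f_i` with ratios
`σ_i ∈ (0, 1)`, and finite index sets `I_k` for `k = 1, 2, …` (the value `index 0` is not used). -/
structure NonautonomousIFS (d : ℕ) where
  map : ℕ → EuclideanSpace ℝ (Fin d) → EuclideanSpace ℝ (Fin d)
  ratio : ℕ → ℝ
  ratio_mem : ∀ i, ratio i ∈ Ioo (0 : ℝ) 1
  contracting : ∀ i x y, dist (map i x) (map i y) ≤ ratio i * dist x y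
  index : ℕ → Finset ℕ

namespace NonautonomousIFS

/-- All the maps are similarities: the contraction inequality is an equality. -/
def OfSimilarities {d : ℕ} (Φ : NonautonomousIFS d) : Prop :=
  ∀ i x y, dist (Φ.map i x) (Φ.map i y) = Φ.ratio i * dist x y

/-- `𝒮^k(B) = ⋃_{i ∈ I_{k+1}} f_i(B)`. -/
def step {d : ℕ} (Φ : NonautonomousIFS d) (k : ℕ) (B : Set (EuclideanSpace ℝ (Fin d))) :
    Set (EuclideanSpace ℝ (Fin d)) :=
  ⋃ i ∈ Φ.index (k + 1), Φ.map i '' B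

/-- `Φ.process n k B` is `𝒮^{k,k+n}(B) = 𝒮^k ∘ ⋯ ∘ 𝒮^{k+n-1} (B)`. -/
def process {d : ℕ} (Φ : NonautonomousIFS d) :
    ℕ → ℕ → Set (EuclideanSpace ℝ (Fin d)) → Set (EuclideanSpace ℝ (Fin d))
  | 0, _, B => B
  | n + 1, k, B => Φ.step k (process Φ n (k + 1) B)

/-- `F⁰, F¹, …` is a pullback attractor of the system. -/
structure IsPullbackAttractor {d : ℕ} (Φ : NonautonomousIFS d)
    (F : ℕ → Set (EuclideanSpace ℝ (Fin d))) : Prop where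
  isCompact : ∀ k, IsCompact (F k)
  uniformlyBounded : Bornology.IsBounded (⋃ k, F k)
  invariant : ∀ k, F k = Φ.step k (F (k + 1))
  attracts : ∀ k, ∀ B : Set (EuclideanSpace ℝ (Fin d)), Bornology.IsBounded B →
    Tendsto (fun n => hausdorffSemiDist (Φ.process n k B) (F k)) atTop (𝓝 0)

/-- The (generalised) Moran open-set condition. -/
def MoranOpenSetCondition {d : ℕ} (Φ : NonautonomousIFS d) : Prop :=
  ∃ U : ℕ → Set (EuclideanSpace ℝ (Fin d)),
    (∀ k, IsOpen (U k)) ∧ (∀ k, (U k).Nonempty) ∧ Bornology.IsBounded (⋃ k, U k) ∧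
    (∀ k, Φ.step k (U (k + 1)) ⊆ U k) ∧
    (∀ k, 1 ≤ k → ∀ i ∈ Φ.index k, ∀ j ∈ Φ.index k, i ≠ j →
      Φ.map i '' U k ∩ Φ.map j '' U k = ∅) ∧
    ∃ ε₀ : ℝ, 0 < ε₀ ∧ ∀ k, ENNReal.ofReal ε₀ ≤ volume (U k)

/-- `J^{k,k+n} = I_{k+1} × ⋯ × I_{k+n}`, as a finite set of words `α` of length `n`. -/
def words {d : ℕ} (Φ : NonautonomousIFS d) (k n : ℕ) : Finset (Fin n → ℕ) :=
  Fintype.piFinset fun j : Fin n => Φ.index (k + 1 + (j : ℕ))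

/-- `σ_α = σ_{i_1} ⋯ σ_{i_n}` for a word `α = (i_1, …, i_n)`. -/
def wordRatio {d : ℕ} (Φ : NonautonomousIFS d) {n : ℕ} (α : Fin n → ℕ) : ℝ :=
  ∏ j, Φ.ratio (α j)

end NonautonomousIFS

end

/-!
For every `F k` the number of `ρ`-balls needed to cover the part of `F k` in a `δ`-ball centred on
`F k` lies between two constant multiples of `(δ / ρ) ^ s`. Equi-homogeneity and the value of the
Assouad dimension are immediate consequences of these bounds
(`isEquiHomogeneous_of_localCover_bounds`, `assouadDim_eq_of_localCover_bounds`).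

To prove the bounds, `F k` is cut into similar copies `f_α(F (k + n))`, one for each word `α` of a
finite cut set, with ratios `σ_α` comparable to a prescribed scale `r` (`Subdivision`). Such cut sets
exist because the ratios of the words from level `k` tend to `0`; this is forced by the attraction of
large balls to the bounded set `F k` (`nonempty_subdivision`). No bound on the ratios away from `1`
is available or needed.

Two facts control the number of pieces.

* With `P_n` the product of the sums `∑ i ∈ I_j, σ_i ^ s` over `1 ≤ j ≤ n`, the numbers
  `σ_α ^ s * P_k / P_{k+n}` sum to `1` over a cut set, by induction along the tree of words. The
  hypothesis on the moment sums says that `P_n` stays between two positive constants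
  (`exists_momentProd_mem_Icc`), so a subdivision of scale `r ≤ 1` has about `r ^ (-s)` pieces,
  uniformly in the level (`Subdivision.card_le`, `Subdivision.le_card`).
* By the open-set condition the sets `f_α(U (k + n))` of a cut set are disjoint, with volumes at
  least a constant times `r ^ d` for `r` in a bounded range, so a ball of radius comparable to `r`
  meets boundedly many pieces (`Subdivision.card_filter_le`).

Subdividing first at a scale about `δ` and then each piece at a scale about `ρ / δ` gives the upper
bound (`IsMoranSystem.exists_localCover_le`); a single piece of scale about `δ` that lies inside the
ball, subdivided again, gives the lower one (`IsMoranSystem.exists_le_localCover`).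
-/

/-! ### Packing and covering -/

theorem injective_of_dist_eq_mul {X Y : Type*} [MetricSpace X] [PseudoMetricSpace Y] {f : X → Y}
    {c : ℝ} (hc : 0 < c) (hf : ∀ x y, dist (f x) (f y) = c * dist x y) :
    Function.Injective f := fun x y hxy => by
  have := hf x y
  rw [hxy, dist_self, eq_comm, mul_eq_zero] at this
  exact dist_eq_zero.1 (this.resolve_left hc.ne')

/-- Only this inequality is needed, and it comes from the behaviour of the `d`-dimensional Hausdorff
measure, a constant multiple of the volume, under the antilipschitz map `f`. -/
theorem ofReal_pow_mul_volume_le_volume_image {d : ℕ}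
    {f : EuclideanSpace ℝ (Fin d) → EuclideanSpace ℝ (Fin d)} {c : ℝ} (hc : 0 < c)
    (hf : ∀ x y, dist (f x) (f y) = c * dist x y) (A : Set (EuclideanSpace ℝ (Fin d))) :
    ENNReal.ofReal (c ^ d) * volume A ≤ volume (f '' A) := by
  have hanti : AntilipschitzWith (Real.toNNReal c⁻¹) f := by
    refine AntilipschitzWith.of_le_mul_dist fun x y => ?_
    rw [hf, Real.coe_toNNReal _ (by positivity), inv_mul_cancel_left₀ hc.ne']
  have : (Measure.hausdorffMeasure (d : ℝ) :
      Measure (EuclideanSpace ℝ (Fin d))).IsAddHaarMeasure := by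
    simpa using isAddHaarMeasure_hausdorffMeasure (E := EuclideanSpace ℝ (Fin d))
  have hvol := Measure.isAddLeftInvariant_eq_smul (volume : Measure (EuclideanSpace ℝ (Fin d)))
    (Measure.hausdorffMeasure (d : ℝ))
  have key := hanti.le_hausdorffMeasure_image (d := (d : ℝ)) (Nat.cast_nonneg d) A
  have hcancel : ENNReal.ofReal (c ^ d) * ((Real.toNNReal c⁻¹ : ℝ≥0) : ℝ≥0∞) ^ (d : ℝ) = 1 := by
    rw [ENNReal.rpow_natCast, ← ENNReal.ofReal, ← ENNReal.ofReal_pow (by positivity),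
      ← ENNReal.ofReal_mul (by positivity), ← mul_pow, mul_inv_cancel₀ hc.ne', one_pow,
      ENNReal.ofReal_one]
  rw [hvol]
  simp only [Measure.smul_apply, ENNReal.smul_def, smul_eq_mul]
  rw [mul_left_comm]
  gcongr
  calc _ ≤ _ := mul_le_mul_right key _
    _ = _ := by rw [← mul_assoc, hcancel, one_mul]

/-- The packing argument: only boundedly many similar copies, of ratio at least `c`, of open sets
of volume at least `ε` fit disjointly into a ball of radius `T`, and the bound depends on `T / c`
only. -/
theorem card_le_of_pairwiseDisjoint_image {d : ℕ} {ι : Type*} (S : Finset ι)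
    (f : ι → EuclideanSpace ℝ (Fin d) → EuclideanSpace ℝ (Fin d)) (τ : ι → ℝ)
    (V : ι → Set (EuclideanSpace ℝ (Fin d))) {c T ε : ℝ} (hc : 0 < c) (hT : 0 ≤ T) (hε : 0 < ε)
    (y : EuclideanSpace ℝ (Fin d)) (hτ : ∀ i ∈ S, c ≤ τ i)
    (hf : ∀ i ∈ S, ∀ x y, dist (f i x) (f i y) = τ i * dist x y)
    (hV : ∀ i ∈ S, IsOpen (V i)) (hvol : ∀ i ∈ S, ENNReal.ofReal ε ≤ volume (V i))
    (hdisj : (S : Set ι).PairwiseDisjoint fun i => f i '' V i)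
    (hsub : ∀ i ∈ S, f i '' V i ⊆ Metric.closedBall y T) :
    (S.card : ℝ) ≤ (T / c) ^ d *
      (volume (Metric.closedBall (0 : EuclideanSpace ℝ (Fin d)) 1)).toReal / ε := by
  have hmeas : ∀ i ∈ S, MeasurableSet (f i '' V i) := fun i hi => by
    have hpos : 0 < τ i := hc.trans_le (hτ i hi)
    have hlip : LipschitzWith (Real.toNNReal (τ i)) (f i) :=
      LipschitzWith.of_dist_le_mul fun x y => by
        rw [hf i hi, Real.coe_toNNReal _ hpos.le]
    refine (hV i hi).measurableSet.image_of_continuousOn_injOn hlip.continuous.continuousOn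
      (injective_of_dist_eq_mul hpos (hf i hi)).injOn
  have hfin : volume (Metric.closedBall (0 : EuclideanSpace ℝ (Fin d)) 1) ≠ ∞ :=
    measure_closedBall_lt_top.ne
  have hle : (S.card : ℝ≥0∞) * ENNReal.ofReal (c ^ d * ε) ≤
      ENNReal.ofReal (T ^ d) * volume (Metric.closedBall (0 : EuclideanSpace ℝ (Fin d)) 1) := by
    calc (S.card : ℝ≥0∞) * ENNReal.ofReal (c ^ d * ε)
        = ∑ _i ∈ S, ENNReal.ofReal (c ^ d * ε) := by simp
      _ ≤ ∑ i ∈ S, volume (f i '' V i) := by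
          refine Finset.sum_le_sum fun i hi => ?_
          have hpos : 0 < τ i := hc.trans_le (hτ i hi)
          refine le_trans ?_ (ofReal_pow_mul_volume_le_volume_image hpos (hf i hi) (V i))
          rw [ENNReal.ofReal_mul (by positivity)]
          exact mul_le_mul' (ENNReal.ofReal_le_ofReal (pow_le_pow_left₀ hc.le (hτ i hi) d))
            (hvol i hi)
      _ = volume (⋃ i ∈ S, f i '' V i) := (measure_biUnion_finset hdisj hmeas).symm
      _ ≤ volume (Metric.closedBall y T) := measure_mono (iUnion₂_subset hsub)
      _ = _ := by rw [Measure.addHaar_closedBall' _ _ hT, finrank_euclideanSpace_fin]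
  have hreal := ENNReal.toReal_mono (ENNReal.mul_ne_top ENNReal.ofReal_ne_top hfin) hle
  rw [ENNReal.toReal_mul, ENNReal.toReal_mul, ENNReal.toReal_natCast,
    ENNReal.toReal_ofReal (by positivity), ENNReal.toReal_ofReal (by positivity)] at hreal
  rw [le_div_iff₀ hε, div_pow, div_mul_eq_mul_div, le_div_iff₀ (by positivity)]
  linarith

/-- The centres of a cover counted by `Metric.coveringNumber` have to lie in `B`; one point of
`A j ∩ B` is chosen for each `j` where there is one. -/
theorem coveringNumber_le_card {X κ : Type*} [PseudoMetricSpace X] {ρ : ℝ≥0} {B : Set X}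
    (J : Finset κ) (A : κ → Set X) (hB : B ⊆ ⋃ j ∈ J, A j)
    (hA : ∀ j ∈ J, ∀ x ∈ A j, ∀ y ∈ A j, dist x y ≤ ρ) :
    Metric.coveringNumber ρ B ≤ J.card := by
  classical
  set J' := J.filter fun j => (A j ∩ B).Nonempty
  have hne : ∀ j : J', (A j ∩ B).Nonempty := fun j => (Finset.mem_filter.1 j.2).2
  choose p hp using hne
  have hcover : Metric.IsCover ρ B (range p) := by
    rw [Metric.isCover_iff_subset_iUnion_closedBall]
    intro x hx
    obtain ⟨j, hj, hxj⟩ := mem_iUnion₂.1 (hB hx)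
    let j' : J' := ⟨j, Finset.mem_filter.2 ⟨hj, x, hxj, hx⟩⟩
    exact mem_iUnion₂.2 ⟨p j', mem_range_self _, hA j hj x hxj _ (hp j').1⟩
  calc Metric.coveringNumber ρ B ≤ (range p).encard :=
        hcover.coveringNumber_le_encard (range_subset_iff.2 fun j => (hp j).2)
    _ ≤ (univ : Set J').encard := by rw [← image_univ]; exact encard_image_le _ _
    _ = J'.card := by simp [encard_univ]
    _ ≤ J.card := by exact_mod_cast Finset.card_filter_le _ _

noncomputable section

/-! ### Moment sums -/

theorem exists_forall_le_of_eventually {u : ℕ → ℝ} {c : ℝ} {N : ℕ} (h : ∀ n, N ≤ n → u n ≤ c) :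
    ∃ b, ∀ n, u n ≤ b := by
  obtain ⟨b, hb⟩ := (isBoundedUnder_of_eventually_le
    (eventually_atTop.2 ⟨N, h⟩)).bddAbove_range
  exact ⟨b, fun n => hb (mem_range_self n)⟩

namespace NonautonomousIFS

variable {d : ℕ}

/-- `P_n = ∏_{j=1}^n ∑_{i ∈ I_j} σ_i^s`, the `s`-th moment sum over the words of length `n` that
start at level `0`. -/
def momentProd (Φ : NonautonomousIFS d) (s : ℝ) (n : ℕ) : ℝ :=
  ∏ j ∈ Finset.range n, ∑ i ∈ Φ.index (j + 1), Φ.ratio i ^ s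

theorem momentProd_succ (Φ : NonautonomousIFS d) (s : ℝ) (n : ℕ) :
    Φ.momentProd s (n + 1) = Φ.momentProd s n * ∑ i ∈ Φ.index (n + 1), Φ.ratio i ^ s :=
  Finset.prod_range_succ _ _

theorem momentProd_pos {Φ : NonautonomousIFS d} (hI : ∀ k, 1 ≤ k → (Φ.index k).Nonempty)
    (s : ℝ) (n : ℕ) : 0 < Φ.momentProd s n :=
  Finset.prod_pos fun j _ => Finset.sum_pos
    (fun i _ => Real.rpow_pos_of_pos (Φ.ratio_mem i).1 s) (hI (j + 1) (by lia))

theorem momentProd_add (Φ : NonautonomousIFS d) (s : ℝ) (k n : ℕ) :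
    Φ.momentProd s (k + n) =
      Φ.momentProd s k * ∑ α ∈ Φ.words k n, Φ.wordRatio α ^ s := by
  have h : ∑ α ∈ Φ.words k n, Φ.wordRatio α ^ s =
      ∏ j : Fin n, ∑ i ∈ Φ.index (k + 1 + (j : ℕ)), Φ.ratio i ^ s := by
    rw [Finset.prod_univ_sum]
    refine Finset.sum_congr rfl fun α _ => ?_
    exact (Real.finsetProd_rpow _ _ (fun j _ => (Φ.ratio_mem _).1.le) s).symm
  rw [h, Fin.prod_univ_eq_prod_range (fun j => ∑ i ∈ Φ.index (k + 1 + j), Φ.ratio i ^ s),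
    momentProd, Finset.prod_range_add]
  simp only [momentProd, add_right_comm]

/-- By multiplicativity, the assumed bounds on the moment sums that start at level `1` bound all
the products `P_n`, and hence the moment sums `P_{k+n} / P_k` at all levels and lengths. -/
theorem exists_momentProd_mem_Icc {Φ : NonautonomousIFS d}
    (hI : ∀ k, 1 ≤ k → (Φ.index k).Nonempty) {s L : ℝ} {n₀ : ℕ} (hL : 0 < L)
    (hsum : ∀ k, 1 ≤ k → ∀ n, n₀ ≤ n →
      L⁻¹ ≤ ∑ α ∈ Φ.words k n, Φ.wordRatio α ^ s ∧
        ∑ α ∈ Φ.words k n, Φ.wordRatio α ^ s ≤ L) :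
    ∃ a b : ℝ, 0 < a ∧ ∀ n, Φ.momentProd s n ∈ Icc a b := by
  have hpos := momentProd_pos hI s
  have hsplit : ∀ n, n₀ + 1 ≤ n → Φ.momentProd s 1 * L⁻¹ ≤ Φ.momentProd s n ∧
      Φ.momentProd s n ≤ Φ.momentProd s 1 * L := fun n hn => by
    obtain ⟨m, rfl⟩ := Nat.exists_eq_add_of_le (show 1 ≤ n by lia)
    rw [momentProd_add]
    have := hsum 1 le_rfl m (by lia)
    exact ⟨mul_le_mul_of_nonneg_left this.1 (hpos 1).le,
      mul_le_mul_of_nonneg_left this.2 (hpos 1).le⟩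
  obtain ⟨b, hb⟩ := exists_forall_le_of_eventually fun n hn => (hsplit n hn).2
  obtain ⟨a, ha⟩ := exists_forall_le_of_eventually (u := fun n => (Φ.momentProd s n)⁻¹)
    fun n hn => inv_anti₀ (mul_pos (hpos 1) (inv_pos.2 hL)) (hsplit n hn).1
  have ha0 : 0 < a := (inv_pos.2 (hpos 0)).trans_le (ha 0)
  exact ⟨a⁻¹, b, inv_pos.2 ha0, fun n => ⟨inv_le_of_inv_le₀ (hpos n) (ha n), hb n⟩⟩

/-! ### Subdivisions -/

theorem iInf_ratio_le (Φ : NonautonomousIFS d) (i : ℕ) : ⨅ j, Φ.ratio j ≤ Φ.ratio i :=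
  ciInf_le ⟨0, by rintro _ ⟨j, rfl⟩; exact (Φ.ratio_mem j).1.le⟩ i

theorem iInf_ratio_le_one (Φ : NonautonomousIFS d) : ⨅ j, Φ.ratio j ≤ 1 :=
  (Φ.iInf_ratio_le 0).trans (Φ.ratio_mem 0).2.le

/-- A decomposition of `F k` into similar copies `f_a(F (level a))` of ratio comparable to `r`,
corresponding to a finite cut set of words `a` starting at level `k`. The words themselves are not
recorded, only the composed similarities `f_a`, their ratios and the levels at which the words end.
The weights `σ_a^s / P_{level a}` add up to the weight of the undivided piece. -/
structure Subdivision (Φ : NonautonomousIFS d) (F U : ℕ → Set (EuclideanSpace ℝ (Fin d)))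
    (s : ℝ) (k : ℕ) (r : ℝ) where
  ι : Type
  fintype : Fintype ι
  map : ι → EuclideanSpace ℝ (Fin d) → EuclideanSpace ℝ (Fin d)
  ratio : ι → ℝ
  level : ι → ℕ
  dist_map : ∀ a x y, dist (map a x) (map a y) = ratio a * dist x y
  ratio_pos : ∀ a, 0 < ratio a
  ratio_le_one : ∀ a, ratio a ≤ 1
  ratio_le : ∀ a, ratio a ≤ r
  le_ratio : ∀ a, ratio a = 1 ∨ (⨅ i, Φ.ratio i) * r ≤ ratio a
  eq_iUnion : F k = ⋃ a, map a '' F (level a)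
  image_subset : ∀ a, map a '' U (level a) ⊆ U k
  disjoint : ∀ a b, a ≠ b → Disjoint (map a '' U (level a)) (map b '' U (level b))
  sum_eq : ∑ a, ratio a ^ s / Φ.momentProd s (level a) = 1 / Φ.momentProd s k

attribute [instance] Subdivision.fintype

namespace Subdivision

variable {Φ : NonautonomousIFS d} {F U : ℕ → Set (EuclideanSpace ℝ (Fin d))} {s : ℝ} {k : ℕ}
  {r : ℝ}

/-- The undivided set, at a scale `r ≥ 1`. -/
def trivial (hr : 1 ≤ r) : Subdivision Φ F U s k r where
  ι := Unit
  fintype := inferInstance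
  map _ := id
  ratio _ := 1
  level _ := k
  dist_map := by simp
  ratio_pos := by simp
  ratio_le_one := by simp
  ratio_le _ := hr
  le_ratio := by simp
  eq_iUnion := by rw [image_id]; exact (iUnion_const (ι := Unit) _).symm
  image_subset := by simp
  disjoint := fun _ _ h => (h rfl).elim
  sum_eq := by simp

/-- At a scale `r < 1`, apply the maps of index `k + 1` and subdivide their images further: the
subdivision in the `i`-th image is one of level `k + 1` and scale `r / σ_i`. -/
def bind (hI : ∀ k, 1 ≤ k → (Φ.index k).Nonempty) (hsim : Φ.OfSimilarities)
    (hF : ∀ k, F k = Φ.step k (F (k + 1))) (hU : ∀ k, Φ.step k (U (k + 1)) ⊆ U k)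
    (hdisj : ∀ k, 1 ≤ k → ∀ i ∈ Φ.index k, ∀ j ∈ Φ.index k, i ≠ j →
      Φ.map i '' U k ∩ Φ.map j '' U k = ∅)
    (hr1 : r < 1)
    (D : ∀ i : Φ.index (k + 1), Subdivision Φ F U s (k + 1) (r / Φ.ratio i)) :
    Subdivision Φ F U s k r where
  ι := Σ i : Φ.index (k + 1), (D i).ι
  fintype := inferInstance
  map a := Φ.map a.1 ∘ (D a.1).map a.2
  ratio a := Φ.ratio a.1 * (D a.1).ratio a.2
  level a := (D a.1).level a.2
  dist_map a x y := by
    simp only [Function.comp_apply]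
    rw [hsim, (D a.1).dist_map, mul_assoc]
  ratio_pos a := mul_pos (Φ.ratio_mem _).1 ((D a.1).ratio_pos _)
  ratio_le_one a := mul_le_one₀ (Φ.ratio_mem _).2.le ((D a.1).ratio_pos _).le
    ((D a.1).ratio_le_one _)
  ratio_le a := by
    have := (D a.1).ratio_le a.2
    rwa [le_div_iff₀' (Φ.ratio_mem _).1] at this
  le_ratio a := by
    refine Or.inr ?_
    rcases (D a.1).le_ratio a.2 with h | h
    -- The `i`-th image is undivided; its ratio `σ_i` is at least the infimum, and `r < 1`.
    · rw [h, mul_one]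
      refine le_trans ?_ (Φ.iInf_ratio_le a.1)
      exact mul_le_of_le_one_right (Real.iInf_nonneg fun i => (Φ.ratio_mem i).1.le) hr1.le
    · rwa [← mul_div_assoc, div_le_iff₀' (Φ.ratio_mem _).1] at h
  eq_iUnion := by
    rw [hF k, step, iUnion_sigma]
    refine (iUnion_subtype (· ∈ Φ.index (k + 1)) fun i => Φ.map i '' F (k + 1)).symm.trans ?_
    refine iUnion_congr fun i => ?_
    rw [(D i).eq_iUnion, image_iUnion]
    simp only [image_comp]
  image_subset a := by
    rw [image_comp]
    refine (image_mono ((D a.1).image_subset a.2)).trans (subset_trans ?_ (hU k))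
    exact subset_iUnion₂_of_subset a.1.1 a.1.2 subset_rfl
  disjoint := by
    rintro ⟨i, a⟩ ⟨j, b⟩ hab
    rcases eq_or_ne i j with rfl | hij
    · have hne : a ≠ b := fun h => hab (by rw [h])
      simp only [image_comp]
      exact (disjoint_image_iff (injective_of_dist_eq_mul (Φ.ratio_mem i).1 (hsim i))).2
        ((D i).disjoint a b hne)
    · simp only [image_comp]
      refine (disjoint_iff_inter_eq_empty.2 (hdisj (k + 1) (by lia) i i.2 j j.2
        fun h => hij (Subtype.ext h))).mono ?_ ?_
      · exact image_mono ((D i).image_subset a)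
      · exact image_mono ((D j).image_subset b)
  sum_eq := by
    rw [Fintype.sum_sigma]
    have hinner : ∀ i : Φ.index (k + 1), ∑ a, (Φ.ratio i * (D i).ratio a) ^ s /
        Φ.momentProd s ((D i).level a) = Φ.ratio i ^ s * (1 / Φ.momentProd s (k + 1)) := by
      intro i
      rw [← (D i).sum_eq, Finset.mul_sum]
      refine Finset.sum_congr rfl fun a _ => ?_
      rw [Real.mul_rpow (Φ.ratio_mem _).1.le ((D i).ratio_pos a).le, mul_div_assoc]
    rw [Finset.sum_congr rfl fun i _ => hinner i, ← Finset.sum_mul,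
      Finset.sum_coe_sort (Φ.index (k + 1)) fun i => Φ.ratio i ^ s, momentProd_succ]
    have h1 := (momentProd_pos hI s k).ne'
    have h2 := (momentProd_pos hI s (k + 1)).ne'
    rw [momentProd_succ] at h2
    have h3 := right_ne_zero_of_mul h2
    field_simp

end Subdivision

theorem image_subset_process {Φ : NonautonomousIFS d} {n k i : ℕ}
    {B C : Set (EuclideanSpace ℝ (Fin d))} (hi : i ∈ Φ.index (k + 1))
    (h : C ⊆ Φ.process n (k + 1) B) : Φ.map i '' C ⊆ Φ.process (n + 1) k B :=
  (image_mono h).trans (subset_iUnion₂_of_subset i hi subset_rfl)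

/-- The ratios of the words starting at a given level tend to `0`, so subdivisions exist at all
scales. Otherwise some words of every length `n` have ratio more than `r`, and `process n k` maps
a large ball to a set that contains two points further apart than any two points of a bounded
neighbourhood of `F k`. -/
theorem nonempty_subdivision {Φ : NonautonomousIFS d} (hd : 1 ≤ d)
    {F U : ℕ → Set (EuclideanSpace ℝ (Fin d))} {s : ℝ}
    (hI : ∀ k, 1 ≤ k → (Φ.index k).Nonempty) (hsim : Φ.OfSimilarities)
    (hF : Φ.IsPullbackAttractor F) (hU : ∀ k, Φ.step k (U (k + 1)) ⊆ U k)
    (hdisj : ∀ k, 1 ≤ k → ∀ i ∈ Φ.index k, ∀ j ∈ Φ.index k, i ≠ j →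
      Φ.map i '' U k ∩ Φ.map j '' U k = ∅)
    (k : ℕ) {r : ℝ} (hr : 0 < r) : Nonempty (Subdivision Φ F U s k r) := by
  by_contra hcon
  have hlong : ∀ n k r, 0 < r → ¬ Nonempty (Subdivision Φ F U s k r) →
      ∃ (g : EuclideanSpace ℝ (Fin d) → EuclideanSpace ℝ (Fin d)) (τ : ℝ), r < τ ∧
        (∀ x y, dist (g x) (g y) = τ * dist x y) ∧ ∀ B, g '' B ⊆ Φ.process n k B := by
    intro n
    induction n with
    | zero =>
      intro k r hr h
      refine ⟨id, 1, ?_, by simp, by simp [process]⟩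
      by_contra! hr1
      exact h ⟨Subdivision.trivial hr1⟩
    | succ n ih =>
      intro k r hr h
      have hr1 : r < 1 := by
        by_contra! hr1
        exact h ⟨Subdivision.trivial hr1⟩
      obtain ⟨i, hi⟩ : ∃ i : Φ.index (k + 1),
          ¬ Nonempty (Subdivision Φ F U s (k + 1) (r / Φ.ratio i)) := by
        by_contra! hall
        exact h ⟨Subdivision.bind hI hsim hF.invariant hU hdisj hr1
          fun i => (hall i).some⟩
      have hσ := (Φ.ratio_mem i).1
      obtain ⟨g, τ, hτ, hg, hgB⟩ := ih (k + 1) (r / Φ.ratio i) (div_pos hr hσ) hi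
      refine ⟨Φ.map i ∘ g, Φ.ratio i * τ, (div_lt_iff₀' hσ).1 hτ, fun x y => ?_, fun B => ?_⟩
      · rw [Function.comp_apply, Function.comp_apply, hsim, hg, mul_assoc]
      · rw [image_comp]
        exact image_subset_process i.2 (hgB B)
  -- An image of a ball of this radius under a similarity of ratio more than `r` contains two points
  -- at distance more than `diam (F k) + 2`.
  set R : ℝ := (Metric.diam (F k) + 2) / r
  have hR : 0 ≤ R := div_nonneg (by positivity) hr.le
  obtain ⟨n, hn⟩ := ((hF.attracts k (Metric.closedBall 0 R)
    Metric.isBounded_closedBall).eventually_lt_const (zero_lt_one)).exists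
  obtain ⟨g, τ, hτ, hg, hgB⟩ := hlong n k r hr hcon
  have : Nonempty (Fin d) := ⟨⟨0, hd⟩⟩
  obtain ⟨v, hv⟩ := NormedSpace.exists_lt_norm ℝ (EuclideanSpace ℝ (Fin d)) 0
  obtain ⟨x, hx⟩ : ∃ x : EuclideanSpace ℝ (Fin d), ‖x‖ = R :=
    ⟨(R / ‖v‖) • v, by rw [norm_smul, Real.norm_of_nonneg (by positivity),
      div_mul_cancel₀ _ hv.ne']⟩
  have hnear : ∀ z ∈ Metric.closedBall (0 : EuclideanSpace ℝ (Fin d)) R,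
      ∃ p ∈ F k, dist (g z) p < 1 := fun z hz => by
    have h1 : Metric.infEDist (g z) (F k) < 1 :=
      lt_of_le_of_lt (le_iSup₂ (f := fun x _ => Metric.infEDist x (F k)) (g z)
        (hgB _ (mem_image_of_mem g hz))) hn
    obtain ⟨p, hp, hlt⟩ := Metric.infEDist_lt_iff.1 h1
    refine ⟨p, hp, ?_⟩
    rw [edist_dist] at hlt
    simpa using (ENNReal.ofReal_lt_one).1 hlt
  obtain ⟨p, hp, hxp⟩ := hnear x (by simp [hx])
  obtain ⟨q, hq, h0q⟩ := hnear 0 (by simpa using hR)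
  have hpq := Metric.dist_le_diam_of_mem (hF.isCompact k).isBounded hp hq
  have hdist : dist (g x) (g 0) = τ * R := by rw [hg, dist_zero_right, hx]
  have htri : dist (g x) (g 0) ≤ dist (g x) p + dist p q + dist (g 0) q := by
    rw [dist_comm (g 0) q]
    exact dist_triangle4 _ _ _ _
  have hbig : Metric.diam (F k) + 2 ≤ τ * R := by
    calc _ = r * R := by rw [mul_div_cancel₀ _ hr.ne']
      _ ≤ τ * R := by gcongr
  linarith

/-- The Hausdorff semi-distance of a non-empty set to the empty set is infinite, so an empty set
attracts nothing. -/
theorem IsPullbackAttractor.nonempty {Φ : NonautonomousIFS d}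
    {F : ℕ → Set (EuclideanSpace ℝ (Fin d))} (hF : Φ.IsPullbackAttractor F)
    (hI : ∀ k, 1 ≤ k → (Φ.index k).Nonempty) (k : ℕ) : (F k).Nonempty := by
  have hproc : ∀ n k, (Φ.process n k {0}).Nonempty := by
    intro n
    induction n with
    | zero => exact fun _ => singleton_nonempty _
    | succ n ih =>
      intro k
      obtain ⟨i, hi⟩ := hI (k + 1) (by lia)
      exact ((ih (k + 1)).image _).mono (image_subset_process hi subset_rfl)
  by_contra hne
  rw [not_nonempty_iff_eq_empty] at hne
  obtain ⟨n, hn⟩ := ((hF.attracts k {0} Bornology.isBounded_singleton).eventually_lt_const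
    zero_lt_one).exists
  obtain ⟨x, hx⟩ := hproc n k
  have := lt_of_le_of_lt (le_iSup₂ (f := fun x _ => Metric.infEDist x (F k)) x hx) hn
  simp [hne] at this


/-! ### Counting pieces -/

/-- The data on which the counting estimates rest: bounds, uniform in the level, for the diameters
of `F k ∪ U k`, the volumes of the open sets `U k` and the moment products, and subdivisions of
every `F k` at every scale. -/
structure IsMoranSystem (Φ : NonautonomousIFS d)
    (F U : ℕ → Set (EuclideanSpace ℝ (Fin d))) (s D ε a b : ℝ) : Prop where
  nonempty : ∀ k, (F k).Nonempty
  isOpen : ∀ k, IsOpen (U k)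
  one_le_diam : 1 ≤ D
  dist_attractor_le : ∀ k, ∀ x ∈ F k, ∀ y ∈ F k, dist x y ≤ D
  dist_open_le : ∀ k, ∀ x ∈ F k, ∀ y ∈ U k, dist x y ≤ D
  eps_pos : 0 < ε
  le_volume : ∀ k, ENNReal.ofReal ε ≤ volume (U k)
  exponent_pos : 0 < s
  lower_pos : 0 < a
  momentProd_mem : ∀ n, Φ.momentProd s n ∈ Icc a b
  iInf_ratio_pos : 0 < ⨅ i, Φ.ratio i
  nonempty_subdivision : ∀ k r, 0 < r → Nonempty (Subdivision Φ F U s k r)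

namespace Subdivision

variable {Φ : NonautonomousIFS d} {F U : ℕ → Set (EuclideanSpace ℝ (Fin d))}
  {s D ε a b : ℝ} {k : ℕ} {r : ℝ}

/-- At a scale `r ≤ 1` every piece has weight at least a constant times `r ^ s`, and the weights add
up to at most a constant. -/
theorem card_le (H : IsMoranSystem Φ F U s D ε a b) (hr : 0 < r) (hr1 : r ≤ 1)
    (S : Subdivision Φ F U s k r) :
    (Fintype.card S.ι : ℝ) ≤ b / a * ((⨅ i, Φ.ratio i) * r) ^ (-s) := by
  set σ := ⨅ i, Φ.ratio i
  have hσ : 0 < σ := H.iInf_ratio_pos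
  have hP : ∀ n, 0 < Φ.momentProd s n := fun n => H.lower_pos.trans_le (H.momentProd_mem n).1
  have hb : 0 < b := (hP 0).trans_le (H.momentProd_mem 0).2
  have hle : ∀ c, σ * r ≤ S.ratio c := fun c => by
    rcases S.le_ratio c with h | h
    · rw [h]; exact mul_le_one₀ Φ.iInf_ratio_le_one hr.le hr1
    · exact h
  have hsum : (Fintype.card S.ι : ℝ) * ((σ * r) ^ s / b) ≤ 1 / a := by
    calc (Fintype.card S.ι : ℝ) * ((σ * r) ^ s / b) = ∑ _c : S.ι, (σ * r) ^ s / b := by simp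
      _ ≤ ∑ c, S.ratio c ^ s / Φ.momentProd s (S.level c) := by
          refine Finset.sum_le_sum fun c _ => div_le_div₀ (Real.rpow_nonneg (S.ratio_pos c).le _)
            (Real.rpow_le_rpow (by positivity) (hle c) H.exponent_pos.le) (hP _)
            (H.momentProd_mem _).2
      _ = 1 / Φ.momentProd s k := S.sum_eq
      _ ≤ 1 / a := one_div_le_one_div_of_le H.lower_pos (H.momentProd_mem k).1
  have ha := H.lower_pos
  rw [Real.rpow_neg (by positivity), ← div_eq_mul_inv, div_div, le_div_iff₀ (by positivity)]
  rw [le_div_iff₀ ha, mul_assoc, div_mul_eq_mul_div, ← mul_div_assoc, div_le_iff₀ hb] at hsum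
  linarith

/-- Every piece has weight at most a constant times `r ^ s`. -/
theorem le_card (H : IsMoranSystem Φ F U s D ε a b) (hr : 0 < r)
    (S : Subdivision Φ F U s k r) :
    a / b * r ^ (-s) ≤ (Fintype.card S.ι : ℝ) := by
  have hP : ∀ n, 0 < Φ.momentProd s n := fun n => H.lower_pos.trans_le (H.momentProd_mem n).1
  have hb : 0 < b := (hP 0).trans_le (H.momentProd_mem 0).2
  have ha := H.lower_pos
  have hsum : 1 / b ≤ (Fintype.card S.ι : ℝ) * (r ^ s / a) := by
    calc 1 / b ≤ 1 / Φ.momentProd s k := one_div_le_one_div_of_le (hP k) (H.momentProd_mem k).2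
      _ = ∑ c, S.ratio c ^ s / Φ.momentProd s (S.level c) := S.sum_eq.symm
      _ ≤ ∑ _c : S.ι, r ^ s / a := by
          refine Finset.sum_le_sum fun c _ => div_le_div₀ (by positivity)
            (Real.rpow_le_rpow (S.ratio_pos c).le (S.ratio_le c) H.exponent_pos.le) ha
            (H.momentProd_mem _).1
      _ = _ := by simp
  rw [Real.rpow_neg hr.le, ← div_eq_mul_inv, div_div, div_le_iff₀ (by positivity)]
  rw [← mul_div_assoc, div_le_div_iff₀ hb ha] at hsum
  linarith

/-- Only boundedly many pieces of comparable ratio meet a ball. The pieces may be transported by a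
further similarity `g`. -/
theorem card_filter_le (H : IsMoranSystem Φ F U s D ε a b) (S : Subdivision Φ F U s k r)
    {g : EuclideanSpace ℝ (Fin d) → EuclideanSpace ℝ (Fin d)} {τ : ℝ} (hτ : 0 < τ)
    (hg : ∀ x y, dist (g x) (g y) = τ * dist x y) {c t T : ℝ} (hc : 0 < c) (hT : 0 ≤ T)
    (hlow : ∀ i, c ≤ τ * S.ratio i) (hup : ∀ i, τ * S.ratio i * D + t ≤ T)
    (y : EuclideanSpace ℝ (Fin d)) (J : Finset S.ι)
    (hJ : ∀ i ∈ J, ((g ∘ S.map i) '' F (S.level i) ∩ Metric.closedBall y t).Nonempty) :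
    (J.card : ℝ) ≤ (T / c) ^ d *
      (volume (Metric.closedBall (0 : EuclideanSpace ℝ (Fin d)) 1)).toReal / ε := by
  have hsim : ∀ i x z, dist ((g ∘ S.map i) x) ((g ∘ S.map i) z) =
      τ * S.ratio i * dist x z := fun i x z => by
    rw [Function.comp_apply, Function.comp_apply, hg, S.dist_map, mul_assoc]
  refine card_le_of_pairwiseDisjoint_image J (fun i => g ∘ S.map i) (fun i => τ * S.ratio i)
    (fun i => U (S.level i)) hc hT H.eps_pos y (fun i _ => hlow i) (fun i _ => hsim i)
    (fun i _ => H.isOpen _) (fun i _ => H.le_volume _) ?_ ?_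
  · intro i _ j _ hij
    simp only [Function.onFun, image_comp]
    exact (disjoint_image_iff (injective_of_dist_eq_mul hτ hg)).2 (S.disjoint i j hij)
  · rintro i hi _ ⟨u, hu, rfl⟩
    obtain ⟨_, ⟨z, hz, rfl⟩, hzy⟩ := hJ i hi
    rw [Metric.mem_closedBall] at hzy ⊢
    calc _ ≤ dist ((g ∘ S.map i) u) ((g ∘ S.map i) z) + dist ((g ∘ S.map i) z) y :=
          dist_triangle _ _ _
      _ ≤ τ * S.ratio i * D + t := by
          rw [hsim, dist_comm u z]
          exact add_le_add (mul_le_mul_of_nonneg_left (H.dist_open_le _ z hz u hu)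
            (hc.le.trans (hlow i))) hzy
      _ ≤ T := hup i

end Subdivision

variable {Φ : NonautonomousIFS d} {F U : ℕ → Set (EuclideanSpace ℝ (Fin d))} {s D ε a b : ℝ}

/-! ### Local covering numbers -/

/-- Boundedly many pieces of ratio about `δ` meet a ball of radius `δ`, and each of them is a union
of at most a constant times `(δ / ρ) ^ s` pieces of diameter at most `ρ`. -/
theorem IsMoranSystem.exists_localCover_le (H : IsMoranSystem Φ F U s D ε a b) (δ₀ : ℝ≥0) :
    ∃ C : ℝ, ∀ k x, ∀ δ ρ : ℝ≥0, 0 < ρ → ρ < δ → δ ≤ δ₀ →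
      localCover (F k) x δ ρ ≤ ENNReal.ofReal (C * ((δ : ℝ) / ρ) ^ s) := by
  classical
  set σ := ⨅ i, Φ.ratio i
  have hσ : 0 < σ := H.iInf_ratio_pos
  have hσ1 : σ ≤ 1 := Φ.iInf_ratio_le_one
  have hD : 0 < D := zero_lt_one.trans_le H.one_le_diam
  have hb : 0 ≤ b := H.lower_pos.le.trans ((H.momentProd_mem 0).1.trans (H.momentProd_mem 0).2)
  have ha := H.lower_pos
  -- `E` accounts for scales above `1`, at which the pieces are undivided and have ratio `1`.
  set E : ℝ := max 1 δ₀
  have hE1 : 1 ≤ E := le_max_left _ _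
  have hE : 0 < E := zero_lt_one.trans_le hE1
  set V := (volume (Metric.closedBall (0 : EuclideanSpace ℝ (Fin d)) 1)).toReal
  refine ⟨((D + 1) * E / σ) ^ d * V / ε * (b / a * (D / σ) ^ s), fun k x δ' ρ' hρ' hρδ' hδ' => ?_⟩
  obtain ⟨δ, hδdef⟩ : ∃ δ : ℝ, δ = δ' := ⟨_, rfl⟩
  obtain ⟨ρ, hρdef⟩ : ∃ ρ : ℝ, ρ = ρ' := ⟨_, rfl⟩
  have hρ : 0 < ρ := by rw [hρdef]; exact_mod_cast hρ'
  have hρδ : ρ < δ := by rw [hρdef, hδdef]; exact_mod_cast hρδ'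
  have hδE : δ ≤ E := by rw [hδdef]; exact le_trans (by exact_mod_cast hδ') (le_max_right _ _)
  have hδ : 0 < δ := hρ.trans hρδ
  -- Since the ratios in the first subdivision are at most `δ`, one scale serves for all the second
  -- subdivisions: the pieces of the pieces have diameter at most `δ * (ρ / (D * δ)) * D = ρ`.
  obtain ⟨S⟩ := H.nonempty_subdivision k δ hδ
  have hr2 : 0 < ρ / (D * δ) := by positivity
  have hr21 : ρ / (D * δ) ≤ 1 := by
    rw [div_le_one (by positivity)]
    nlinarith [H.one_le_diam]
  obtain ⟨S'⟩ : Nonempty (∀ i : S.ι, Subdivision Φ F U s (S.level i) (ρ / (D * δ))) :=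
    ⟨fun i => (H.nonempty_subdivision (S.level i) (ρ / (D * δ)) hr2).some⟩
  set J := Finset.univ.filter fun i : S.ι =>
    ((id ∘ S.map i) '' F (S.level i) ∩ Metric.closedBall x δ).Nonempty
  have hlow : ∀ i, σ * δ / E ≤ 1 * S.ratio i := fun i => by
    rw [one_mul, div_le_iff₀ hE]
    have := S.ratio_pos i
    rcases S.le_ratio i with h | h
    · rw [h]; nlinarith
    · nlinarith
  have hJ : (J.card : ℝ) ≤ ((D + 1) * E / σ) ^ d * V / ε := by
    have := S.card_filter_le H one_pos (g := id) (by simp) (c := σ * δ / E) (t := δ)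
      (T := (D + 1) * δ) (by positivity) (by positivity) hlow (fun i => by
        have := S.ratio_le i
        nlinarith) x J (fun i hi => (Finset.mem_filter.1 hi).2)
    rwa [show (D + 1) * δ / (σ * δ / E) = (D + 1) * E / σ by field_simp] at this
  have hcard : ((J.sigma fun i => (Finset.univ : Finset (S' i).ι)).card : ℝ) ≤
      ((D + 1) * E / σ) ^ d * V / ε * (b / a * (D / σ) ^ s) * (δ / ρ) ^ s := by
    rw [Finset.card_sigma, Nat.cast_sum]
    calc ∑ i ∈ J, ((Finset.univ : Finset (S' i).ι).card : ℝ)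
        ≤ ∑ _i ∈ J, b / a * (σ * (ρ / (D * δ))) ^ (-s) :=
          Finset.sum_le_sum fun i _ => (S' i).card_le H hr2 hr21
      _ = J.card * (b / a * (σ * (ρ / (D * δ))) ^ (-s)) := by simp
      _ ≤ ((D + 1) * E / σ) ^ d * V / ε * (b / a * (σ * (ρ / (D * δ))) ^ (-s)) := by gcongr
      _ = _ := by
          have : σ * (ρ / (D * δ)) = (D / σ * (δ / ρ))⁻¹ := by field_simp
          rw [this, Real.inv_rpow (by positivity), Real.rpow_neg (by positivity), inv_inv,
            Real.mul_rpow (by positivity) (by positivity)]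
          ring
  have hcover := coveringNumber_le_card (ρ := ρ') (B := Metric.closedBall x δ ∩ F k)
    (J.sigma fun i => (Finset.univ : Finset (S' i).ι))
    (fun p => (S.map p.1 ∘ (S' p.1).map p.2) '' F ((S' p.1).level p.2)) ?_ ?_
  · rw [localCover, ← hδdef, ← hρdef]
    calc _ ≤ ((((J.sigma fun i => (Finset.univ : Finset (S' i).ι)).card : ℕ∞)) : ℝ≥0∞) :=
          ENat.toENNReal_mono hcover
      _ = ENNReal.ofReal ((J.sigma fun i => (Finset.univ : Finset (S' i).ι)).card : ℝ) := by
          rw [ENNReal.ofReal_natCast, ENat.toENNReal_coe]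
      _ ≤ _ := ENNReal.ofReal_le_ofReal hcard
  · rintro z ⟨hzx, hz⟩
    rw [S.eq_iUnion] at hz
    obtain ⟨i, w, hw, rfl⟩ := mem_iUnion.1 hz
    have hi : i ∈ J := Finset.mem_filter.2 ⟨Finset.mem_univ _, _, ⟨w, hw, rfl⟩, hzx⟩
    rw [(S' i).eq_iUnion] at hw
    obtain ⟨j, v, hv, rfl⟩ := mem_iUnion.1 hw
    exact mem_iUnion₂.2 ⟨⟨i, j⟩, Finset.mem_sigma.2 ⟨hi, Finset.mem_univ _⟩, v, hv, rfl⟩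
  · rintro ⟨i, j⟩ _ _ ⟨u, hu, rfl⟩ _ ⟨v, hv, rfl⟩
    rw [Function.comp_apply, Function.comp_apply, S.dist_map, (S' i).dist_map, ← hρdef]
    calc S.ratio i * ((S' i).ratio j * dist u v) ≤ δ * (ρ / (D * δ) * D) := by
          gcongr
          · have := (S' i).ratio_pos j; positivity
          · exact S.ratio_le i
          · exact (S' i).ratio_le j
          · exact H.dist_attractor_le _ u hu v hv
      _ = ρ := by field_simp

/-- Around each of its points `F k` contains a whole piece of ratio about `δ`. It consists of at
least a constant times `(δ / ρ) ^ s` pieces of ratio about `ρ`, of which a ball of radius `ρ` meets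
boundedly many. -/
theorem IsMoranSystem.exists_le_localCover (H : IsMoranSystem Φ F U s D ε a b) (δ₀ : ℝ≥0) :
    ∃ c : ℝ, 0 < c ∧ ∀ k, ∀ x ∈ F k, ∀ δ ρ : ℝ≥0, 0 < ρ → ρ < δ → δ ≤ δ₀ →
      ENNReal.ofReal (c * ((δ : ℝ) / ρ) ^ s) ≤ localCover (F k) x δ ρ := by
  classical
  set σ := ⨅ i, Φ.ratio i
  have hσ : 0 < σ := H.iInf_ratio_pos
  have hσ1 : σ ≤ 1 := Φ.iInf_ratio_le_one
  have hD1 := H.one_le_diam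
  have hD : 0 < D := zero_lt_one.trans_le hD1
  have ha := H.lower_pos
  have hb : 0 < b := ha.trans_le ((H.momentProd_mem 0).1.trans (H.momentProd_mem 0).2)
  have hε := H.eps_pos
  -- `E` accounts for scales above `1`, at which the pieces are undivided and have ratio `1`.
  set E : ℝ := max 1 δ₀
  have hE1 : 1 ≤ E := le_max_left _ _
  have hE : 0 < E := zero_lt_one.trans_le hE1
  set V := (volume (Metric.closedBall (0 : EuclideanSpace ℝ (Fin d)) 1)).toReal
  have hV : 0 < V := ENNReal.toReal_pos (Metric.measure_closedBall_pos _ _ one_pos).ne'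
    measure_closedBall_lt_top.ne
  set M := (2 * D * E / σ ^ 2) ^ d * V / ε
  have hM0 : 0 < M := by positivity
  refine ⟨a / b / M, by positivity, fun k x hx δ' ρ' hρ' hρδ' hδ' => ?_⟩
  obtain ⟨δ, hδdef⟩ : ∃ δ : ℝ, δ = δ' := ⟨_, rfl⟩
  obtain ⟨ρ, hρdef⟩ : ∃ ρ : ℝ, ρ = ρ' := ⟨_, rfl⟩
  have hρ : 0 < ρ := by rw [hρdef]; exact_mod_cast hρ'
  have hρδ : ρ < δ := by rw [hρdef, hδdef]; exact_mod_cast hρδ'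
  have hδE : δ ≤ E := by rw [hδdef]; exact le_trans (by exact_mod_cast hδ') (le_max_right _ _)
  have hδ : 0 < δ := hρ.trans hρδ
  rw [localCover, ← hδdef, ← hρdef]
  by_cases htop : Metric.coveringNumber ρ' (Metric.closedBall x δ ∩ F k) = ⊤
  · simp [htop]
  obtain ⟨N, hNsub, hNfin, hNcover, hNcard⟩ := Metric.exists_set_encard_eq_coveringNumber htop
  obtain ⟨S⟩ := H.nonempty_subdivision k (δ / D) (by positivity)
  obtain ⟨i, w, hw, rfl⟩ : ∃ i, x ∈ S.map i '' F (S.level i) := by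
    rw [S.eq_iUnion] at hx
    exact mem_iUnion.1 hx
  have hpiece : S.map i '' F (S.level i) ⊆ Metric.closedBall (S.map i w) δ ∩ F k := by
    refine subset_inter ?_ ?_
    · rintro _ ⟨v, hv, rfl⟩
      rw [Metric.mem_closedBall, S.dist_map]
      calc S.ratio i * dist v w ≤ δ / D * D :=
            mul_le_mul (S.ratio_le i) (H.dist_attractor_le _ v hv w hw) dist_nonneg (by positivity)
        _ = δ := div_mul_cancel₀ _ hD.ne'
    · exact (subset_iUnion (fun i => S.map i '' F (S.level i)) i).trans S.eq_iUnion.superset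
  have hr2 : 0 < ρ / δ := by positivity
  have hr21 : ρ / δ ≤ 1 := (div_le_one hδ).2 hρδ.le
  obtain ⟨S'⟩ := H.nonempty_subdivision (S.level i) (ρ / δ) hr2
  have hSlow : σ * δ / (D * E) ≤ S.ratio i := by
    rcases S.le_ratio i with h | h
    · rw [h, div_le_one (by positivity)]
      calc σ * δ ≤ 1 * E := by gcongr
        _ ≤ D * E := by gcongr
    · refine le_trans ?_ h
      rw [div_mul_eq_div_div, ← mul_div_assoc]
      exact div_le_self (by positivity) hE1
  have hS'low : ∀ j, σ * (ρ / δ) ≤ S'.ratio j := fun j => by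
    rcases S'.le_ratio j with h | h
    · rw [h]; exact mul_le_one₀ hσ1 hr2.le hr21
    · exact h
  let K : EuclideanSpace ℝ (Fin d) → Finset S'.ι := fun y => Finset.univ.filter fun j =>
    ((S.map i ∘ S'.map j) '' F (S'.level j) ∩ Metric.closedBall y ρ).Nonempty
  have hmeet : ∀ y, ((K y).card : ℝ) ≤ M := by
    intro y
    have := S'.card_filter_le H (S.ratio_pos i) (S.dist_map i) (c := σ ^ 2 * ρ / (D * E)) (t := ρ)
      (T := 2 * ρ) (by positivity) (by positivity) (fun j => ?_) (fun j => ?_) y (K y)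
      (fun j hj => (Finset.mem_filter.1 hj).2)
    · rwa [show 2 * ρ / (σ ^ 2 * ρ / (D * E)) = 2 * D * E / σ ^ 2 by field_simp] at this
    · calc σ ^ 2 * ρ / (D * E) = σ * δ / (D * E) * (σ * (ρ / δ)) := by field_simp
        _ ≤ _ := mul_le_mul hSlow (hS'low j) (by positivity) (S.ratio_pos i).le
    · calc S.ratio i * S'.ratio j * D + ρ ≤ δ / D * (ρ / δ) * D + ρ := by
            gcongr
            · exact (S'.ratio_pos j).le
            · exact S.ratio_le i
            · exact S'.ratio_le j
        _ = 2 * ρ := by field_simp; ring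
  have hunion : (Finset.univ : Finset S'.ι) ⊆ hNfin.toFinset.biUnion K := by
    intro j _
    obtain ⟨v, hv⟩ := H.nonempty (S'.level j)
    have hvF : S'.map j v ∈ F (S.level i) := by
      rw [S'.eq_iUnion]
      exact mem_iUnion.2 ⟨j, mem_image_of_mem _ hv⟩
    rw [Metric.isCover_iff_subset_iUnion_closedBall] at hNcover
    obtain ⟨y, hy, hvy⟩ := mem_iUnion₂.1 (hNcover (hpiece (mem_image_of_mem _ hvF)))
    rw [← hρdef] at hvy
    exact Finset.mem_biUnion.2 ⟨y, hNfin.mem_toFinset.2 hy,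
      Finset.mem_filter.2 ⟨Finset.mem_univ _, _, ⟨v, hv, rfl⟩, hvy⟩⟩
  have hcount : a / b * (δ / ρ) ^ s ≤ hNfin.toFinset.card * M := by
    calc a / b * (δ / ρ) ^ s = a / b * (ρ / δ) ^ (-s) := by
          rw [Real.rpow_neg hr2.le, ← Real.inv_rpow hr2.le, inv_div]
      _ ≤ Fintype.card S'.ι := S'.le_card H hr2
      _ ≤ ∑ y ∈ hNfin.toFinset, ((K y).card : ℝ) := by
          exact_mod_cast (Finset.card_le_card hunion).trans Finset.card_biUnion_le
      _ ≤ ∑ _y ∈ hNfin.toFinset, M := Finset.sum_le_sum fun y _ => hmeet y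
      _ = _ := by simp
  rw [← hNcard, hNfin.encard_eq_coe_toFinset_card, ENat.toENNReal_coe, ← ENNReal.ofReal_natCast]
  refine ENNReal.ofReal_le_ofReal ?_
  rw [div_mul_eq_mul_div, div_le_iff₀ hM0]
  exact hcount

end NonautonomousIFS

/-! ### Equi-homogeneity and the Assouad dimension from covering bounds -/

section TwoSided

variable {X : Type*} [PseudoMetricSpace X] {F : Set X} {s : ℝ}

theorem isEquiHomogeneous_of_localCover_bounds
    (hup : ∀ δ₀ : ℝ≥0, ∃ C : ℝ, ∀ x, ∀ δ ρ : ℝ≥0, 0 < ρ → ρ < δ → δ ≤ δ₀ →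
      localCover F x δ ρ ≤ ENNReal.ofReal (C * ((δ : ℝ) / ρ) ^ s))
    (hlow : ∀ δ₀ : ℝ≥0, ∃ c : ℝ, 0 < c ∧ ∀ x ∈ F, ∀ δ ρ : ℝ≥0, 0 < ρ → ρ < δ → δ ≤ δ₀ →
      ENNReal.ofReal (c * ((δ : ℝ) / ρ) ^ s) ≤ localCover F x δ ρ) :
    IsEquiHomogeneous F := by
  intro δ₀ _
  obtain ⟨C, hC⟩ := hup δ₀
  obtain ⟨c, hc, hcl⟩ := hlow δ₀
  refine ⟨max 1 (C / c).toNNReal, 1, 1, le_max_left _ _, one_pos, one_pos,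
    fun δ ρ hρ hρδ hδ => ?_⟩
  simp only [one_mul]
  calc (⨆ x ∈ F, localCover F x δ ρ) ≤ ENNReal.ofReal (C * ((δ : ℝ) / ρ) ^ s) :=
        iSup₂_le fun x _ => hC x δ ρ hρ hρδ hδ
    _ = ENNReal.ofReal (C / c * (c * ((δ : ℝ) / ρ) ^ s)) := by
        rw [← mul_assoc, div_mul_cancel₀ _ hc.ne']
    _ = ENNReal.ofReal (C / c) * ENNReal.ofReal (c * ((δ : ℝ) / ρ) ^ s) :=
        ENNReal.ofReal_mul' (by positivity)
    _ ≤ _ := mul_le_mul' (ENNReal.coe_le_coe.2 (le_max_right _ _))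
        (le_iInf₂ fun x hx => hcl x hx δ ρ hρ hρδ hδ)

theorem assouadDim_eq_of_localCover_bounds (hs : 0 ≤ s) (hne : F.Nonempty)
    (hup : ∀ δ₀ : ℝ≥0, ∃ C : ℝ, ∀ x, ∀ δ ρ : ℝ≥0, 0 < ρ → ρ < δ → δ ≤ δ₀ →
      localCover F x δ ρ ≤ ENNReal.ofReal (C * ((δ : ℝ) / ρ) ^ s))
    (hlow : ∀ δ₀ : ℝ≥0, ∃ c : ℝ, 0 < c ∧ ∀ x ∈ F, ∀ δ ρ : ℝ≥0, 0 < ρ → ρ < δ → δ ≤ δ₀ →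
      ENNReal.ofReal (c * ((δ : ℝ) / ρ) ^ s) ≤ localCover F x δ ρ) :
    assouadDim F = ENNReal.ofReal s := by
  refine le_antisymm ?_ ?_
  · refine iInf₂_le_of_le s.toNNReal (fun δ₀ _ => ?_) le_rfl
    obtain ⟨C, hC⟩ := hup δ₀
    refine ⟨max 1 C.toNNReal, lt_max_of_lt_left one_pos, fun δ ρ hρ hρδ hδ =>
      iSup₂_le fun x _ => (hC x δ ρ hρ hρδ hδ).trans ?_⟩
    rw [ENNReal.ofReal]
    refine ENNReal.coe_le_coe.2 (Real.toNNReal_le_iff_le_coe.2 ?_)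
    push_cast
    rw [Real.coe_toNNReal _ hs]
    gcongr
    exact (Real.le_coe_toNNReal C).trans (le_max_right _ _)
  · refine le_iInf₂ fun t ht => ?_
    rw [ENNReal.ofReal, ENNReal.coe_le_coe, Real.toNNReal_le_iff_le_coe]
    by_contra! hts
    obtain ⟨C, hC0, hC⟩ := ht 1 one_pos
    obtain ⟨c, hc, hcl⟩ := hlow 1
    obtain ⟨x, hx⟩ := hne
    -- With `δ = 1` and `ρ = 1 / u` the bounds give `c * u ^ s ≤ C * u ^ t`, which fails for large
    -- `u` if `t < s`.
    obtain ⟨u, hu, hu1⟩ := (((tendsto_rpow_atTop (sub_pos.2 hts)).eventually_gt_atTop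
      ((C : ℝ) / c)).and (eventually_gt_atTop 1)).exists
    have hu0 : 0 < u := one_pos.trans hu1
    have hρ : 0 < u⁻¹.toNNReal := Real.toNNReal_pos.2 (inv_pos.2 hu0)
    have hρ1 : u⁻¹.toNNReal < 1 := by
      rw [Real.toNNReal_lt_one]
      exact inv_lt_one_of_one_lt₀ hu1
    have h := (hcl x hx 1 _ hρ hρ1 le_rfl).trans
      ((le_iSup₂ (f := fun x _ => localCover F x 1 u⁻¹.toNNReal) x hx).trans
        (hC 1 _ hρ hρ1 le_rfl))
    rw [ENNReal.ofReal, ENNReal.coe_le_coe, Real.toNNReal_le_iff_le_coe] at h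
    push_cast at h
    rw [Real.coe_toNNReal _ (inv_pos.2 hu0).le, one_div, inv_inv] at h
    rw [Real.rpow_sub hu0, div_lt_div_iff₀ hc (by positivity)] at hu
    linarith

end TwoSided
end

theorem mainTheorem2 {d : ℕ} (hd : 1 ≤ d) (Φ : NonautonomousIFS d)
    (hI : ∀ k, 1 ≤ k → (Φ.index k).Nonempty)
    (hsim : Φ.OfSimilarities) (hU : Φ.MoranOpenSetCondition)
    (F : ℕ → Set (EuclideanSpace ℝ (Fin d))) (hF : Φ.IsPullbackAttractor F)
    (hinf : 0 < ⨅ i, Φ.ratio i)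
    (s : ℝ) (hs : 0 < s) (n₀ : ℕ) (L : ℝ) (hL : 0 < L)
    (hsum : ∀ k, 1 ≤ k → ∀ n, n₀ ≤ n →
      L⁻¹ ≤ ∑ α ∈ Φ.words k n, Φ.wordRatio α ^ s ∧
        ∑ α ∈ Φ.words k n, Φ.wordRatio α ^ s ≤ L) :
    ∀ k, IsEquiHomogeneous (F k) ∧ assouadDim (F k) = ENNReal.ofReal s := by
  obtain ⟨U, hopen, _, hbdd, hmaps, hdisj, ε, hε, hvol⟩ := hU
  obtain ⟨a, b, ha, hab⟩ := NonautonomousIFS.exists_momentProd_mem_Icc hI hL hsum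
  have hbounded := hF.uniformlyBounded.union hbdd
  have hdist : ∀ x ∈ (⋃ k, F k) ∪ ⋃ k, U k, ∀ y ∈ (⋃ k, F k) ∪ ⋃ k, U k,
      dist x y ≤ max 1 (Metric.diam ((⋃ k, F k) ∪ ⋃ k, U k)) := fun x hx y hy =>
    (Metric.dist_le_diam_of_mem hbounded hx hy).trans (le_max_right _ _)
  have H : NonautonomousIFS.IsMoranSystem Φ F U s
      (max 1 (Metric.diam ((⋃ k, F k) ∪ ⋃ k, U k))) ε a b :=
    { nonempty := hF.nonempty hI
      isOpen := hopen
      one_le_diam := le_max_left _ _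
      dist_attractor_le := fun k x hx y hy =>
        hdist x (Or.inl (mem_iUnion_of_mem k hx)) y (Or.inl (mem_iUnion_of_mem k hy))
      dist_open_le := fun k x hx y hy =>
        hdist x (Or.inl (mem_iUnion_of_mem k hx)) y (Or.inr (mem_iUnion_of_mem k hy))
      eps_pos := hε
      le_volume := hvol
      exponent_pos := hs
      lower_pos := ha
      momentProd_mem := hab
      iInf_ratio_pos := hinf
      nonempty_subdivision := fun k r hr =>
        NonautonomousIFS.nonempty_subdivision hd hI hsim hF hmaps hdisj k hr }
  intro k
  have hup := fun δ₀ : ℝ≥0 => (H.exists_localCover_le δ₀).imp fun C hC => hC k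
  have hlow := fun δ₀ : ℝ≥0 => (H.exists_le_localCover δ₀).imp fun c hc =>
    hc.imp_right fun h => h k
  exact ⟨isEquiHomogeneous_of_localCover_bounds hup hlow,
    assouadDim_eq_of_localCover_bounds hs.le (hF.nonempty hI k) hup hlow⟩
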